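/- Let $\Bbbk$ be an algebraically closed field of characteristic zero, let $N\ge 1$, $H=\Bbbk[D]$, and let $V_N=H^N$ be the free $N$-generated $H$-module. Let $\mathrm{Cend}_N=H\otimes M_N(\Bbbk[v])=M_N(\Bbbk[D,v])$ be the associative conformal algebra whose products $\circ_n$ $(n\ge 0)$ are the bilinear operations determined by $A(v)\circ_n B(v)=A(v)\,\partial_v^n(B(v))$ for $A,B\in M_N(\Bbbk[v])$, $\;Da\circ_n b=-n\,a\circ_{n-1}b$, and $a\circ_n Db=D(a\circ_n b)+n\,a\circ_{n-1}b$. It acts on $V_N$ as follows: for $a=\sum_{s\ge 0}\frac{(-D)^s}{s!}\otimes A_s(v)$ and $u\in V_N$, $$a\circ_n u=\sum_{s\ge 0}\binom{n}{s}A_s(D)\,\partial_D^{\,n-s}(u).$$ A conformal subalgebra is a $D$-invariant subspace $C\subseteq \mathrm{Cend}_N$ closed under all products $\circ_n$. It is called irreducible if the only $H$-submodules $U\subseteq V_N$ with $a\circ_n U\subseteq U$ for all $a\in C$, $n\ge 0$, are $0$ and $V_N$. A left ideal of $\mathrm{Cend}_N$ is a $D$-invariant subspace $I$ with $a\circ_n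 I\subseteq I$ for all $a\in\mathrm{Cend}_N$, $n\ge 0$. Theorem. Let $C\subseteq \mathrm{Cend}_N$ be an irreducible conformal subalgebra. Then there is a matrix $Q=Q(v)\in M_N(\Bbbk[v])$ with $\det Q\neq 0$ such that $$\Bbbk[v]C=C+vC+v^2C+\cdots=\mathrm{Cend}_{N,Q},\qquad \mathrm{Cend}_{N,Q}:=M_N(\Bbbk[D,v])\,Q(-D+v)$$ (ordinary matrix product), and $\mathrm{Cend}_{N,Q}$ is a left ideal of $\mathrm{Cend}_N$. -/

import Mathlib

open Polynomial

namespace ConfCend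

/-- The underlying space of the conformal algebra `Cend_N`, identified with
`H ⊗ M_N(k[v]) = M_N(k[D, v])`, where `H = k[D]`. An entry is an element of `k[v][D]`:
the outer polynomial variable is `D`, the inner one is `v`. -/
abbrev Cend (k : Type*) [Field k] (N : ℕ) : Type _ := Matrix (Fin N) (Fin N) k[X][X]

/-- The free `N`-generated `H`-module `V_N = H^N`, where `H = k[D]`. -/
abbrev VN (k : Type*) [Field k] (N : ℕ) : Type _ := Fin N → k[X]

variable {k : Type*} [Field k] {N : ℕ}

/-- The variable `D` of `k[v][D]`. -/
noncomputable def dVar (k : Type*) [Field k] : k[X][X] := X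

/-- The variable `v` of `k[v][D]`. -/
noncomputable def vVar (k : Type*) [Field k] : k[X][X] := C X

/-- The partial derivative `∂_v` on `k[v][D]`. -/
noncomputable def pderivV (f : k[X][X]) : k[X][X] := f.sum fun s c => monomial s (derivative c)

/-- The operator `∂_D + ∂_v` on `M_N(k[D, v])`. -/
noncomputable def delta (a : Cend k N) : Cend k N :=
  a.map fun f => derivative f + pderivV f

/-- The matrices `A_s(v) ∈ M_N(k[v])` of the expansion
`a = ∑_s (-D)^s / s! ⊗ A_s(v)` of an element of `Cend_N` (see `sum_dcoeff`). -/
noncomputable def dcoeff (a : Cend k N) (s : ℕ) : Matrix (Fin N) (Fin N) k[X] :=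
  a.map fun f => ((-1) ^ s * (s.factorial : k[X])) * f.coeff s

/-- The embedding `M_N(k[v]) → M_N(k[D, v])`, `A ↦ 1 ⊗ A`. -/
noncomputable def incl (A : Matrix (Fin N) (Fin N) k[X]) : Cend k N := A.map C

/-- The conformal products `a ∘_n b` of `Cend_N`. By `nprod_incl`, `nprod_D_left` and
`nprod_D_right` below, this is the sesquilinear family with
`A(v) ∘_n B(v) = A(v) ∂_v^n (B(v))` for `A, B ∈ M_N(k[v])`. -/
noncomputable def nprod (a : Cend k N) (n : ℕ) (b : Cend k N) : Cend k N :=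
  ∑ s ∈ Finset.range (n + 1), n.choose s • (incl (dcoeff a s) * delta^[n - s] b)

theorem coeff_pderivV (f : k[X][X]) (s : ℕ) : (pderivV f).coeff s = derivative (f.coeff s) := by
  rw [pderivV, Polynomial.sum, finsetSum_coeff]
  simp only [coeff_monomial]
  rw [Finset.sum_ite_eq' f.support s]
  split_ifs with h
  · rfl
  · rw [notMem_support_iff.1 h, map_zero]

theorem sum_dcoeff [CharZero k] (a : Cend k N) (m : ℕ) (hm : ∀ i j, (a i j).natDegree < m) :
    a = ∑ s ∈ Finset.range m,
      C (C ((s.factorial : k)⁻¹)) • (-dVar k) ^ s • incl (dcoeff a s) := by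
  ext1 i j
  rw [Matrix.sum_apply]
  conv_lhs => rw [(a i j).as_sum_range' m (hm i j)]
  refine Finset.sum_congr rfl fun s _ => ?_
  have h : ((s.factorial : k)⁻¹) * (s.factorial : k) = 1 :=
    inv_mul_cancel₀ (by exact_mod_cast s.factorial_ne_zero)
  have h2 : (C (C ((s.factorial : k)⁻¹)) : k[X][X]) * C (C (s.factorial : k)) = 1 := by
    rw [← C_mul, ← C_mul, h, C_1, C_1]
  have h3 : ((-1 : k[X][X]) ^ s) * (-1) ^ s = 1 := pow_mul_pow_eq_one s (by ring)
  simp only [Matrix.smul_apply, smul_eq_mul, incl, dcoeff, Matrix.map_apply, map_mul, map_pow,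
    map_neg, map_one, map_natCast, dVar]
  rw [map_natCast, map_natCast] at h2
  rw [← C_mul_X_pow_eq_monomial, neg_pow (X : k[X][X])]
  linear_combination (-(C ((a i j).coeff s) * X ^ s)) * ((-1) ^ s * (-1) ^ s) * h2
    - C ((a i j).coeff s) * X ^ s * h3

theorem pderivV_C (f : k[X]) : pderivV (C f) = C (derivative f) := by
  ext1 s
  rw [coeff_pderivV, coeff_C, coeff_C]
  split_ifs <;> simp

theorem pderivV_add (f g : k[X][X]) : pderivV (f + g) = pderivV f + pderivV g := by
  ext1 s
  simp [coeff_pderivV]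

theorem pderivV_dVar_mul (f : k[X][X]) : pderivV (dVar k * f) = dVar k * pderivV f := by
  ext1 s
  cases s <;> simp [coeff_pderivV, dVar, coeff_X_mul]

theorem delta_add (a b : Cend k N) : delta (a + b) = delta a + delta b := by
  ext1 i j
  simp only [delta, Matrix.map_apply, Matrix.add_apply, pderivV_add, derivative_add]
  ring

theorem delta_incl (n : ℕ) (B : Matrix (Fin N) (Fin N) k[X]) :
    delta^[n] (incl B) = incl (B.map fun f => derivative^[n] f) := by
  induction n with
  | zero => rfl
  | succ n ih =>
    rw [Function.iterate_succ_apply', ih]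
    ext1 i j
    simp [delta, incl, pderivV_C, Function.iterate_succ_apply']

theorem delta_dVar_smul (n : ℕ) (b : Cend k N) :
    delta^[n] (dVar k • b) = dVar k • delta^[n] b + n • delta^[n - 1] b := by
  induction n with
  | zero => simp
  | succ n ih =>
    have h1 : ∀ a : Cend k N, delta (dVar k • a) = dVar k • delta a + a := by
      intro a
      ext1 i j
      simp only [delta, Matrix.map_apply, Matrix.smul_apply, Matrix.add_apply, smul_eq_mul,
        pderivV_dVar_mul, derivative_mul]
      simp only [dVar, derivative_X]
      ring
    have h2 : ∀ (m : ℕ) (a : Cend k N), delta (m • a) = m • delta a := by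
      intro m a
      exact map_nsmul (AddMonoidHom.mk' delta delta_add) m a
    rw [Function.iterate_succ_apply', ih, delta_add, h1, h2, Function.iterate_succ_apply',
      add_assoc, Nat.add_sub_cancel, succ_nsmul']
    rcases n with _ | n
    · simp
    · rw [Nat.add_sub_cancel, ← Function.iterate_succ_apply' delta n b]

/-- `A(v) ∘_n B(v) = A(v) ∂_v^n (B(v))`. -/
theorem nprod_incl (A B : Matrix (Fin N) (Fin N) k[X]) (n : ℕ) :
    nprod (incl A) n (incl B) = incl (A * B.map fun f => derivative^[n] f) := by
  rw [nprod, Finset.sum_eq_single_of_mem 0 (by simp)]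
  · have : dcoeff (incl A) 0 = A := by
      ext1 i j
      simp [dcoeff, incl]
    rw [this, delta_incl]
    simp [incl, Matrix.map_mul]
  · intro s _ hs
    have : dcoeff (incl A) s = 0 := by
      ext1 i j
      simp [dcoeff, incl, coeff_C, hs]
    rw [this]
    simp [incl]

/-- `D a ∘_n b = -n (a ∘_{n-1} b)`. -/
theorem nprod_D_left (a b : Cend k N) (n : ℕ) :
    nprod (dVar k • a) n b = -(n • nprod a (n - 1) b) := by
  have h0 : dcoeff (dVar k • a) 0 = 0 := by
    ext1 i j
    simp [dcoeff, dVar]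
  have h1 : ∀ s, incl (dcoeff (dVar k • a) (s + 1)) = -((s + 1) • incl (dcoeff a s)) := by
    intro s
    ext1 i j
    rw [Matrix.neg_apply, Matrix.smul_apply]
    simp only [dcoeff, dVar, incl, Matrix.map_apply, Matrix.smul_apply, smul_eq_mul, coeff_X_mul,
      Nat.factorial_succ, nsmul_eq_mul, map_mul, map_pow, map_neg, map_one, map_natCast]
    push_cast
    ring
  rcases n with _ | n
  · simp [nprod, h0, incl]
  · rw [nprod, Finset.sum_range_succ', h0, nprod, Nat.add_sub_cancel, Finset.smul_sum,
      ← Finset.sum_neg_distrib]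
    have : incl (0 : Matrix (Fin N) (Fin N) k[X]) = 0 := by simp [incl]
    rw [this, zero_mul, smul_zero, add_zero]
    refine Finset.sum_congr rfl fun s _ => ?_
    rw [h1, Matrix.neg_mul, smul_neg, Matrix.smul_mul, smul_smul, smul_smul,
      ← Nat.add_one_mul_choose_eq, Nat.add_sub_add_right]

/-- `a ∘_n D b = D (a ∘_n b) + n (a ∘_{n-1} b)`. -/
theorem nprod_D_right (a b : Cend k N) (n : ℕ) :
    nprod a n (dVar k • b) = dVar k • nprod a n b + n • nprod a (n - 1) b := by
  rcases n with _ | n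
  · simp [nprod]
  · simp only [nprod, delta_dVar_smul, mul_add, smul_add, Finset.sum_add_distrib, Matrix.mul_smul]
    congr 1
    · rw [Finset.smul_sum]
      exact Finset.sum_congr rfl fun s _ => smul_comm _ _ _
    · rw [Finset.sum_range_succ, Nat.sub_self, zero_smul, smul_zero, add_zero, Nat.add_sub_cancel,
        Finset.smul_sum]
      refine Finset.sum_congr rfl fun s hs => ?_
      have hs' : s ≤ n := Nat.lt_succ_iff.1 (Finset.mem_range.1 hs)
      rw [smul_smul, smul_smul, Nat.sub_right_comm, Nat.add_sub_cancel, mul_comm (n + 1),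
        Nat.choose_mul_succ_eq]

/-- The action of `Cend_N` on `V_N`: for `a = ∑_s (-D)^s / s! ⊗ A_s(v)`,
`a ∘_n u = a_n (u) = ∑_s (n choose s) A_s(D) ∂_D^(n-s) (u)`. -/
noncomputable def act (a : Cend k N) (n : ℕ) (u : VN k N) : VN k N :=
  ∑ s ∈ Finset.range (n + 1),
    n.choose s • (dcoeff a s).mulVec fun i => derivative^[n - s] (u i)

/-- A conformal subalgebra of `Cend_N`: a subspace closed under `D` and all products `∘_n`. -/
structure IsConformalSubalgebra (S : Submodule k (Cend k N)) : Prop where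
  D_mem : ∀ a ∈ S, dVar k • a ∈ S
  nprod_mem : ∀ a ∈ S, ∀ b ∈ S, ∀ n : ℕ, nprod a n b ∈ S

/-- A left ideal of `Cend_N`: a subspace closed under `D` and under all left multiplications
by elements of `Cend_N`. -/
structure IsLeftIdeal (I : Submodule k (Cend k N)) : Prop where
  D_mem : ∀ a ∈ I, dVar k • a ∈ I
  nprod_mem : ∀ a : Cend k N, ∀ b ∈ I, ∀ n : ℕ, nprod a n b ∈ I

/-- A subset `S` of `Cend_N` is irreducible if the only `S`-submodules of `V_N`
(the `H`-submodules closed under all `a ∘_n`, `a ∈ S`) are `0` and `V_N`. -/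
def IsIrreducibleOn (S : Submodule k (Cend k N)) : Prop :=
  ∀ U : Submodule k[X] (VN k N),
    (∀ a ∈ S, ∀ n : ℕ, ∀ u ∈ U, act a n u ∈ U) → U = ⊥ ∨ U = ⊤

/-- The subspace `k[v] S = S + v S + v² S + ⋯` of `Cend_N`. -/
noncomputable def vSpan (S : Submodule k (Cend k N)) : Submodule k (Cend k N) :=
  ⨆ n : ℕ, S.map (Algebra.lsmul k k (Cend k N) (vVar k ^ n))

/-- The matrix `Q(-D + v) ∈ M_N(k[D, v])` for `Q = Q(v) ∈ M_N(k[v])`. -/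
noncomputable def shiftQ (Q : Matrix (Fin N) (Fin N) k[X]) : Cend k N :=
  Q.map fun f => aeval (-dVar k + vVar k) f

/-- The subspace `Cend_{N,Q} = M_N(k[D, v]) Q(-D + v)` (ordinary matrix product). -/
noncomputable def CendQ (Q : Matrix (Fin N) (Fin N) k[X]) : Submodule k (Cend k N) :=
  LinearMap.range (LinearMap.mulRight k (shiftQ Q))

end ConfCend

/-!
Write `w = v - D`, so that `M_N(k[D, v]) = M_N(k[v, w])` and each column of an element is a
polynomial in `w` with coefficients in `V_N`. The derivation `∂_D + ∂_v` is `∂_v` at fixed `w`, so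
`a ∘_n b` is the operator `a ∘_n` of `V_N` applied to these column coefficients, with `w` a mere
parameter (`colCoeff_nprod`). Multiplication by `v` is likewise multiplication by `D` on `V_N`.

The algebra `R` of operators on `V_N` generated by `D` and all `a ∘_n`, `a ∈ S`, is irreducible, and
its commutant consists of scalars because an operator commuting with `D` acts on the
finite-dimensional space `V_N / D V_N` (`exists_smul_of_operatorAlgebra_linear`). By the Jacobson
density theorem every linear operator `T` of `V_N` agrees on any finite set with one in `R`. Since `R`
preserves `k[v] S`, and an element of `k[v] S` has finitely many column coefficients, `k[v] S` is
stable under every such `T` (`exists_mem_vSpan_colCoeff_eq`). Hence `k[v] S` is `V_N ⊗ J` for a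
`k[w]`-submodule `J` of the module `k[w]^N` of rows (`rowMat_mem_vSpan`, `eq_sum_rowMat`), and as
`k[w]` is a principal ideal domain, `J` is the row space of a square matrix `Q(w)`; this is the
equality with `Cend_{N,Q}`.

Finally `Q(w)` is killed by `∂_D + ∂_v`, so `Cend_{N,Q}` is a left ideal, and every operator of
`Cend_{N,Q}` kills the kernel of `Q` on `V_N` (`act_eq_zero_of_mem_CendQ`). That kernel is therefore
invariant; it is not all of `V_N`, for otherwise `S` acts by zero and `D V_N` is a proper nonzero
invariant submodule. So it vanishes and `det Q ≠ 0`.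
-/

namespace ConfCend

variable {k : Type*} [Field k] {N : ℕ}

/-! ### Rows and columns in the coordinates `v` and `v - D` -/

/-- The change of variables `D ↦ v - D` of `k[v][D]`, an involution over `k[v]`. -/
noncomputable def flipD : k[X][X] →ₐ[k[X]] k[X][X] := aeval (C X - X)

theorem flipD_C (f : k[X]) : flipD (C f) = C f := by
  simp [flipD]

theorem flipD_X : flipD (X : k[X][X]) = C X - X := by
  simp [flipD]

theorem flipD_flipD (f : k[X][X]) : flipD (flipD f) = f := by
  have h : (flipD.comp flipD : k[X][X] →ₐ[k[X]] k[X][X]) = AlgHom.id _ _ := by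
    ext1
    simp [flipD_X, flipD_C]
  exact DFunLike.congr_fun h f

theorem pderivV_mul (f g : k[X][X]) : pderivV (f * g) = pderivV f * g + f * pderivV g := by
  ext1 s
  simp only [coeff_pderivV, coeff_add, coeff_mul, derivative_sum, derivative_mul,
    Finset.sum_add_distrib]

theorem derivative_add_pderivV_mul (f g : k[X][X]) :
    derivative (f * g) + pderivV (f * g) =
      (derivative f + pderivV f) * g + f * (derivative g + pderivV g) := by
  rw [pderivV_mul, derivative_mul]
  ring

theorem pderivV_X : pderivV (X : k[X][X]) = 0 := by
  ext1 s
  rw [coeff_pderivV, coeff_X]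
  split_ifs <;> simp

theorem pderivV_flipD (f : k[X][X]) : pderivV (flipD f) = flipD (derivative f + pderivV f) := by
  induction f using Polynomial.induction_on' with
  | add f g hf hg =>
    rw [map_add, pderivV_add, hf, hg, ← map_add, derivative_add, pderivV_add]
    congr 1
    ring
  | monomial n c =>
    rw [← C_mul_X_pow_eq_monomial]
    induction n with
    | zero => simp [flipD_C, pderivV_C]
    | succ n ih =>
      have hX : pderivV (C X - X : k[X][X]) = 1 := by
        have h := pderivV_add (C X - X : k[X][X]) X
        rw [sub_add_cancel, pderivV_C, pderivV_X] at h
        simpa using h.symm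
      rw [pow_succ, ← mul_assoc]
      generalize C c * X ^ n = g at ih ⊢
      rw [map_mul, pderivV_mul, ih, derivative_add_pderivV_mul, derivative_X, pderivV_X, flipD_X,
        hX, add_zero]
      generalize derivative g + pderivV g = d
      rw [map_add, map_mul, map_mul, flipD_X, map_one]

/-- The coefficient of `(v - D)^i` in the `j`-th column of a matrix over `k[v][D]`, as an element
of `V_N` (its variable `v` being renamed to `D`). -/
noncomputable def colCoeff (j : Fin N) (i : ℕ) : Cend k N →ₗ[k] VN k N where
  toFun c := fun l => (flipD (c l j)).coeff i
  map_add' a b := by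
    ext1 l
    simp
  map_smul' r a := by
    ext1 l
    have h : r • a l j = (C r : k[X]) • a l j := by
      ext1 s
      simp [smul_eq_C_mul]
    simp only [Matrix.smul_apply, RingHom.id_apply, Pi.smul_apply]
    rw [h, map_smul, coeff_smul, smul_eq_C_mul, smul_eq_mul]

theorem colCoeff_apply (j : Fin N) (i : ℕ) (c : Cend k N) (l : Fin N) :
    colCoeff j i c l = (flipD (c l j)).coeff i := rfl

theorem eq_of_colCoeff_eq {a b : Cend k N} (h : ∀ j i, colCoeff j i a = colCoeff j i b) :
    a = b := by
  ext1 l j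
  rw [← flipD_flipD (a l j), ← flipD_flipD (b l j)]
  congr 1
  ext1 i
  exact congrFun (h j i) l

theorem colCoeff_vVar_smul (j : Fin N) (i : ℕ) (c : Cend k N) :
    colCoeff j i (vVar k • c) = (X : k[X]) • colCoeff j i c := by
  ext1 l
  simp [colCoeff_apply, vVar, flipD_C]

theorem colCoeff_incl_mul (j : Fin N) (i : ℕ) (A : Matrix (Fin N) (Fin N) k[X])
    (b : Cend k N) : colCoeff j i (incl A * b) = A.mulVec (colCoeff j i b) := by
  ext1 l
  simp [colCoeff_apply, incl, Matrix.mul_apply, Matrix.mulVec, dotProduct, flipD_C,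
    finsetSum_coeff]

theorem colCoeff_delta_iterate (j : Fin N) (i n : ℕ) (b : Cend k N) :
    colCoeff j i (delta^[n] b) = fun l => derivative^[n] (colCoeff j i b l) := by
  induction n with
  | zero => rfl
  | succ n ih =>
    rw [Function.iterate_succ_apply']
    ext1 l
    rw [Function.iterate_succ_apply', ← congrFun ih l, colCoeff_apply, colCoeff_apply, delta,
      Matrix.map_apply, ← pderivV_flipD, coeff_pderivV]

/-- In the coordinates `v` and `v - D`, the product `a ∘_n b` is the action of `a` on the
columns of `b`, with `v - D` as a parameter. -/
theorem colCoeff_nprod (j : Fin N) (i n : ℕ) (a b : Cend k N) :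
    colCoeff j i (nprod a n b) = act a n (colCoeff j i b) := by
  rw [nprod, act, map_sum]
  refine Finset.sum_congr rfl fun s _ => ?_
  rw [map_nsmul, colCoeff_incl_mul, colCoeff_delta_iterate]

/-- The operator `a ∘_n` on `V_N`. -/
noncomputable def actEnd (a : Cend k N) (n : ℕ) : Module.End k (VN k N) where
  toFun := act a n
  map_add' u w := by
    simp only [act, ← Finset.sum_add_distrib, ← smul_add, ← Matrix.mulVec_add]
    refine Finset.sum_congr rfl fun s _ => ?_
    congr 2
    ext1 i
    exact iterate_map_add derivative _ _ _
  map_smul' r u := by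
    simp only [act, Finset.smul_sum, RingHom.id_apply]
    refine Finset.sum_congr rfl fun s _ => ?_
    have h : (fun i => derivative^[n - s] ((r • u) i)) =
        r • fun i => derivative^[n - s] (u i) := by
      ext1 i
      exact iterate_derivative_smul r (u i) (n - s)
    rw [h, Matrix.mulVec_smul, smul_comm]

/-- Multiplication by `D` on `V_N`. -/
noncomputable def mulD (k : Type*) [Field k] (N : ℕ) : Module.End k (VN k N) :=
  Algebra.lsmul k k (VN k N) (X : k[X])

theorem act_X_smul (a : Cend k N) (n : ℕ) (u : VN k N) :
    act a n ((X : k[X]) • u) = (X : k[X]) • act a n u + n • act a (n - 1) u := by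
  have h : ∀ m : ℕ, (fun i => derivative^[m] (((X : k[X]) • u) i)) =
      (X : k[X]) • (fun i => derivative^[m] (u i)) + m • fun i => derivative^[m - 1] (u i) := by
    intro m
    ext1 i
    simp only [Pi.smul_apply, Pi.add_apply, smul_eq_mul]
    rw [mul_comm X, iterate_derivative_mul_X]
    simp [mul_comm]
  rcases n with _ | n
  · simp only [act, h, zero_smul, add_zero]
    simp [Matrix.mulVec_smul]
  · simp only [act, h, Matrix.mulVec_add, Matrix.mulVec_smul, smul_add, Finset.sum_add_distrib]
    congr 1
    · rw [Finset.smul_sum]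
      exact Finset.sum_congr rfl fun s _ => smul_comm _ _ _
    · rw [Finset.sum_range_succ, Nat.sub_self, zero_smul, smul_zero (M := ℕ), add_zero,
        Nat.add_sub_cancel, Finset.smul_sum]
      refine Finset.sum_congr rfl fun s hs => ?_
      have hs' : s ≤ n := Nat.lt_succ_iff.1 (Finset.mem_range.1 hs)
      rw [smul_smul, smul_smul, Nat.sub_right_comm, Nat.add_sub_cancel, mul_comm (n + 1),
        Nat.choose_mul_succ_eq]

theorem nprod_vVar_smul (a b : Cend k N) (n : ℕ) :
    nprod a n (vVar k • b) = vVar k • nprod a n b + n • nprod a (n - 1) b := by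
  refine eq_of_colCoeff_eq fun j i => ?_
  rw [map_add, map_nsmul, colCoeff_vVar_smul, colCoeff_nprod, colCoeff_nprod, colCoeff_nprod,
    colCoeff_vVar_smul, act_X_smul]

/-! ### Density of the operators of an irreducible subset -/

/-- The algebra of operators on `V_N` generated by `D` and by all `a ∘_n` with `a ∈ S`. -/
noncomputable def operatorAlgebra (S : Submodule k (Cend k N)) :
    Subalgebra k (Module.End k (VN k N)) :=
  Algebra.adjoin k ({mulD k N} ∪ {T | ∃ a ∈ S, ∃ n, T = actEnd a n})

theorem mulD_mem (S : Submodule k (Cend k N)) : mulD k N ∈ operatorAlgebra S :=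
  Algebra.subset_adjoin (Or.inl rfl)

theorem actEnd_mem {S : Submodule k (Cend k N)} {a : Cend k N} (ha : a ∈ S) (n : ℕ) :
    actEnd a n ∈ operatorAlgebra S :=
  Algebra.subset_adjoin (Or.inr ⟨a, ha, n, rfl⟩)

theorem isSimpleModule_operatorAlgebra (hN : 0 < N) {S : Submodule k (Cend k N)}
    (hirr : IsIrreducibleOn S) : IsSimpleModule (operatorAlgebra S) (VN k N) := by
  have : Nonempty (Fin N) := ⟨⟨0, hN⟩⟩
  rw [isSimpleModule_iff]
  refine { exists_pair_ne := ⟨⊥, ⊤, bot_ne_top⟩, eq_bot_or_eq_top := fun U => ?_ }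
  have hX : ∀ u ∈ U, (X : k[X]) • u ∈ U := fun u hu =>
    U.smul_mem (⟨mulD k N, mulD_mem S⟩ : operatorAlgebra S) hu
  have hk : ∀ (r : k), ∀ u ∈ U, r • u ∈ U := fun r u hu =>
    U.smul_mem (algebraMap k (operatorAlgebra S) r) hu
  let U' : Submodule k[X] (VN k N) :=
    { U.toAddSubmonoid with
      smul_mem' := by
        intro p u hu
        induction p using Polynomial.induction_on' with
        | add p q hp hq => rw [add_smul]; exact U.add_mem hp hq
        | monomial n c =>
          induction n with
          | zero =>
            have h := hk c u hu
            rwa [← algebraMap_smul k[X] c u] at h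
          | succ n ih =>
            rw [← monomial_mul_X, mul_comm, mul_smul]
            exact hX _ ih }
  rcases hirr U' fun a ha n u hu =>
      U.smul_mem (⟨actEnd a n, actEnd_mem ha n⟩ : operatorAlgebra S) hu with h | h
  · left
    ext u
    exact (SetLike.ext_iff.1 h u)
  · right
    ext u
    exact (SetLike.ext_iff.1 h u)

/-- Schur's lemma for `V_N`: an operator commuting with an irreducible subset and with `D` induces
an endomorphism of the finite-dimensional space `V_N / D V_N`, hence has an eigenvalue there, and
subtracting that eigenvalue makes it non-surjective, so zero. -/
theorem exists_smul_of_operatorAlgebra_linear [IsAlgClosed k] (hN : 0 < N)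
    {S : Submodule k (Cend k N)} (hirr : IsIrreducibleOn S)
    (φ : Module.End (operatorAlgebra S) (VN k N)) : ∃ r : k, ∀ u, φ u = r • u := by
  have : Nonempty (Fin N) := ⟨⟨0, hN⟩⟩
  have := isSimpleModule_operatorAlgebra hN hirr
  have hφk : ∀ (r : k) u, φ (r • u) = r • φ u := fun r u =>
    map_smul φ (algebraMap k (operatorAlgebra S) r) u
  have hφX : ∀ u, φ ((X : k[X]) • u) = (X : k[X]) • φ u := fun u =>
    map_smul φ (⟨mulD k N, mulD_mem S⟩ : operatorAlgebra S) u
  -- `ψ` is the endomorphism induced by `φ` on `V_N / D V_N`, identified with `k^N`.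
  let ψ : Module.End k (Fin N → k) :=
    { toFun := fun z i => (φ (fun l => C (z l)) i).coeff 0
      map_add' := by
        intro z w
        have : (fun l => C ((z + w) l) : VN k N) = (fun l => C (z l)) + fun l => C (w l) := by
          ext1 l; simp
        ext1 i
        rw [this, map_add]
        simp
      map_smul' := by
        intro r z
        have : (fun l => C ((r • z) l) : VN k N) = r • fun l => C (z l) := by
          ext1 l; simp [smul_eq_C_mul]
        ext1 i
        rw [this, hφk]
        simp }
  obtain ⟨r, hr⟩ := Module.End.exists_eigenvalue ψ
  obtain ⟨z, hz⟩ := hr.exists_hasEigenvector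
  refine ⟨r, ?_⟩
  let χ : Module.End (operatorAlgebra S) (VN k N) :=
    { toFun := fun u => φ u - r • u
      map_add' := fun u w => by rw [map_add, smul_add]; abel
      map_smul' := fun t u => by
        rw [map_smul, RingHom.id_apply, smul_sub]
        congr 1
        exact (map_smul (t : Module.End k (VN k N)) r u).symm }
  rcases LinearMap.bijective_or_eq_zero (R := operatorAlgebra S) χ with h | h
  · exfalso
    have hχX : ∀ u, χ ((X : k[X]) • u) = (X : k[X]) • χ u := fun u => by
      change φ _ - r • _ = X • (φ u - r • u)
      rw [hφX, smul_sub, smul_comm]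
    have h0 : ∀ i, (χ (fun l => C (z l)) i).coeff 0 = 0 := by
      intro i
      have h1 := congrFun hz.apply_eq_smul i
      change (φ (fun l => C (z l)) i).coeff 0 = r • z i at h1
      change (φ (fun l => C (z l)) i - r • C (z i)).coeff 0 = 0
      rw [coeff_sub, h1]
      simp
    -- `χ` maps the constant eigenvector `z` into `D V_N = χ (D V_N)`, against injectivity.
    obtain ⟨u, hu⟩ := h.surjective (fun i => divX (χ (fun l => C (z l)) i))
    have h2 : χ ((X : k[X]) • u) = χ (fun l => C (z l)) := by
      rw [hχX, hu]
      ext1 i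
      conv_rhs => rw [← X_mul_divX_add (χ (fun l => C (z l)) i), h0]
      simp
    apply hz.2
    ext1 i
    have h3 := congrArg (fun p => coeff p 0) (congrFun (h.injective h2) i)
    simpa using h3.symm
  · intro u
    exact sub_eq_zero.1 (DFunLike.congr_fun h u)

/-- The Jacobson density theorem for an irreducible subset of `Cend_N`. -/
theorem exists_mem_operatorAlgebra_eqOn [IsAlgClosed k] (hN : 0 < N)
    {S : Submodule k (Cend k N)} (hirr : IsIrreducibleOn S) (T : Module.End k (VN k N))
    (s : Finset (VN k N)) : ∃ R ∈ operatorAlgebra S, ∀ u ∈ s, T u = R u := by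
  have := isSimpleModule_operatorAlgebra hN hirr
  let f : Module.End (Module.End (operatorAlgebra S) (VN k N)) (VN k N) :=
    { toFun := T
      map_add' := map_add T
      map_smul' := fun φ u => by
        obtain ⟨r, hr⟩ := exists_smul_of_operatorAlgebra_linear hN hirr φ
        change T (φ u) = φ (T u)
        rw [hr, hr, map_smul] }
  obtain ⟨R, hR⟩ := jacobson_density (R := operatorAlgebra S) f s
  exact ⟨R, R.2, hR⟩

/-! ### The module `k[v] S` -/

theorem vSpan_vVar_smul_mem {S : Submodule k (Cend k N)} {c : Cend k N} (hc : c ∈ vSpan S) :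
    vVar k • c ∈ vSpan S := by
  rw [vSpan] at hc ⊢
  induction hc using Submodule.iSup_induction' with
  | mem n c hc =>
    obtain ⟨a, ha, rfl⟩ := hc
    refine Submodule.mem_iSup_of_mem (n + 1) ⟨a, ha, ?_⟩
    change vVar k ^ (n + 1) • a = vVar k • vVar k ^ n • a
    rw [pow_succ', mul_smul]
  | zero => simp
  | add a b _ _ ha hb => rw [smul_add]; exact add_mem ha hb

theorem vSpan_dVar_smul_mem {S : Submodule k (Cend k N)} (hS : IsConformalSubalgebra S)
    {c : Cend k N} (hc : c ∈ vSpan S) : dVar k • c ∈ vSpan S := by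
  rw [vSpan] at hc ⊢
  induction hc using Submodule.iSup_induction' with
  | mem n c hc =>
    obtain ⟨a, ha, rfl⟩ := hc
    exact Submodule.mem_iSup_of_mem n ⟨_, hS.D_mem a ha, smul_comm (vVar k ^ n) (dVar k) a⟩
  | zero => simp
  | add a b _ _ ha hb => rw [smul_add]; exact add_mem ha hb

theorem nprod_add_right (a : Cend k N) (n : ℕ) (b c : Cend k N) :
    nprod a n (b + c) = nprod a n b + nprod a n c := by
  refine eq_of_colCoeff_eq fun j i => ?_
  simp only [colCoeff_nprod, map_add]
  exact map_add (actEnd a n) _ _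

theorem nprod_zero_right (a : Cend k N) (n : ℕ) : nprod a n 0 = 0 := by
  simpa using nprod_add_right a n 0 0

theorem vSpan_nprod_mem {S : Submodule k (Cend k N)} (hS : IsConformalSubalgebra S)
    {a : Cend k N} (ha : a ∈ S) (n : ℕ) {c : Cend k N} (hc : c ∈ vSpan S) :
    nprod a n c ∈ vSpan S := by
  have key : ∀ (m n : ℕ), ∀ b ∈ S, nprod a n (vVar k ^ m • b) ∈ vSpan S := by
    intro m
    induction m with
    | zero =>
      intro n b hb
      refine Submodule.mem_iSup_of_mem 0 ⟨_, hS.nprod_mem a ha b hb n, ?_⟩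
      simp
    | succ m ih =>
      intro n b hb
      rw [pow_succ', mul_smul, nprod_vVar_smul]
      exact add_mem (vSpan_vVar_smul_mem (ih n b hb)) (nsmul_mem (ih _ b hb) n)
  rw [vSpan] at hc
  induction hc using Submodule.iSup_induction' with
  | mem m c hc =>
    obtain ⟨b, hb, rfl⟩ := hc
    exact key m n b hb
  | zero => rw [nprod_zero_right]; exact zero_mem _
  | add b c _ _ hb hc => rw [nprod_add_right]; exact add_mem hb hc

theorem smul_mem_of_vVar_dVar {I : Submodule k (Cend k N)}
    (hv : ∀ c ∈ I, vVar k • c ∈ I) (hD : ∀ c ∈ I, dVar k • c ∈ I) (f : k[X][X])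
    {c : Cend k N} (hc : c ∈ I) : f • c ∈ I := by
  induction f using Polynomial.induction_on' with
  | add f g hf hg => rw [add_smul]; exact add_mem hf hg
  | monomial n f =>
    rw [← C_mul_X_pow_eq_monomial, mul_comm, mul_smul]
    have hf : C f • c ∈ I := by
      induction f using Polynomial.induction_on' with
      | add f g hf hg => rw [C_add, add_smul]; exact add_mem hf hg
      | monomial m r =>
        rw [← C_mul_X_pow_eq_monomial, mul_comm, C_mul, mul_smul]
        have hr : (C (C r) : k[X][X]) • c ∈ I := by
          have h : (C (C r) : k[X][X]) • c = r • c := by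
            ext1 i j
            ext1 s
            simp [smul_eq_C_mul]
          rw [h]
          exact I.smul_mem r hc
        induction m with
        | zero => rwa [pow_zero, C_1, one_smul]
        | succ m ih => rw [pow_succ', C_mul, mul_smul]; exact hv _ ih
    induction n with
    | zero => rwa [pow_zero, one_smul]
    | succ n ih => rw [pow_succ', mul_smul]; exact hD _ ih

/-- The operators generated by `D` and by an irreducible conformal subalgebra act columnwise on
`k[v] S`; by density so does every linear operator of `V_N`. -/
theorem exists_mem_vSpan_colCoeff_eq [IsAlgClosed k] (hN : 0 < N) {S : Submodule k (Cend k N)}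
    (hS : IsConformalSubalgebra S) (hirr : IsIrreducibleOn S) (T : Module.End k (VN k N))
    {c : Cend k N} (hc : c ∈ vSpan S) :
    ∃ c' ∈ vSpan S, ∀ j i, colCoeff j i c' = T (colCoeff j i c) := by
  have key : ∀ R ∈ operatorAlgebra S, ∀ c ∈ vSpan S,
      ∃ c' ∈ vSpan S, ∀ j i, colCoeff j i c' = R (colCoeff j i c) := by
    intro R hR
    induction hR using Algebra.adjoin_induction with
    | mem R hR =>
      intro c hc
      rcases hR with rfl | ⟨a, ha, n, rfl⟩
      · exact ⟨_, vSpan_vVar_smul_mem hc, fun j i => colCoeff_vVar_smul j i c⟩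
      · exact ⟨_, vSpan_nprod_mem hS ha n hc, fun j i => colCoeff_nprod j i n a c⟩
    | algebraMap r =>
      intro c hc
      exact ⟨r • c, Submodule.smul_mem _ r hc, fun j i => by
        rw [map_smul, Module.algebraMap_end_apply]⟩
    | add P R _ _ hP hR =>
      intro c hc
      obtain ⟨c₁, h₁, e₁⟩ := hP c hc
      obtain ⟨c₂, h₂, e₂⟩ := hR c hc
      exact ⟨c₁ + c₂, add_mem h₁ h₂, fun j i => by
        rw [map_add, e₁, e₂, LinearMap.add_apply]⟩
    | mul P R _ _ hP hR =>
      intro c hc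
      obtain ⟨c₁, h₁, e₁⟩ := hR c hc
      obtain ⟨c₂, h₂, e₂⟩ := hP c₁ h₁
      exact ⟨c₂, h₂, fun j i => by rw [e₂, e₁, Module.End.mul_apply]⟩
  -- Only finitely many of the vectors `colCoeff j i c` are nonzero.
  obtain ⟨m, hm⟩ : ∃ m, ∀ j i, m ≤ i → colCoeff j i c = 0 := by
    refine ⟨(Finset.univ.sup fun p : Fin N × Fin N => (flipD (c p.1 p.2)).natDegree) + 1, ?_⟩
    intro j i hi
    ext1 l
    refine coeff_eq_zero_of_natDegree_lt (lt_of_lt_of_le (Nat.lt_succ_of_le ?_) hi)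
    exact Finset.le_sup (f := fun p : Fin N × Fin N => (flipD (c p.1 p.2)).natDegree)
      (Finset.mem_univ (l, j))
  classical
  obtain ⟨R, hR, hTR⟩ := exists_mem_operatorAlgebra_eqOn hN hirr T
    ((Finset.univ ×ˢ Finset.range m).image fun p : Fin N × ℕ => colCoeff p.1 p.2 c)
  obtain ⟨c', hc', e⟩ := key R hR c hc
  refine ⟨c', hc', fun j i => ?_⟩
  rw [e]
  rcases lt_or_ge i m with hi | hi
  · exact (hTR _ (Finset.mem_image.2 ⟨(j, i), by simpa using hi, rfl⟩)).symm
  · rw [hm j i hi, map_zero, map_zero]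

/-! ### Row decomposition -/

/-- The matrix over `k[v][D]` whose `l`-th row is `r(v - D)` and whose other rows vanish. -/
noncomputable def rowMat (l : Fin N) : (Fin N → k[X]) →ₗ[k] Cend k N where
  toFun r := Matrix.of fun i j => if i = l then aeval (-dVar k + vVar k) (r j) else 0
  map_add' r t := by
    ext1 i j
    by_cases h : i = l <;> simp [h]
  map_smul' a r := by
    ext1 i j
    by_cases h : i = l <;> simp [h]

theorem rowMat_apply (l : Fin N) (r : Fin N → k[X]) (i j : Fin N) :
    rowMat l r i j = if i = l then aeval (-dVar k + vVar k) (r j) else 0 := rfl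

theorem rowMat_smul (l : Fin N) (p : k[X]) (r : Fin N → k[X]) :
    rowMat l (p • r) = aeval (-dVar k + vVar k) p • rowMat l r := by
  ext1 i j
  by_cases h : i = l <;> simp [rowMat_apply, h]

/-- The coefficient of `v^n` in the `l`-th row of a matrix written in the coordinates `v` and
`v - D`: a row of polynomials in `v - D`. -/
noncomputable def rowCoeff (l : Fin N) (n : ℕ) (c : Cend k N) : Fin N → k[X] :=
  fun j => (Bivariate.swap (flipD (c l j))).coeff n

theorem flipD_aeval (f : k[X]) : flipD (aeval (-dVar k + vVar k) f) = f.map C := by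
  induction f using Polynomial.induction_on' with
  | add p q hp hq => rw [map_add, map_add, hp, hq, Polynomial.map_add]
  | monomial n a =>
    rw [aeval_monomial, map_mul, map_pow, map_add, map_neg, dVar, vVar, flipD_X, flipD_C,
      Polynomial.map_monomial, ← C_mul_X_pow_eq_monomial]
    congr 1
    · exact flipD_C _
    · congr 1
      ring

theorem eq_sum_vVar_mul (f : k[X][X]) :
    f = ∑ n ∈ (Bivariate.swap (flipD f)).support,
      vVar k ^ n * aeval (-dVar k + vVar k) ((Bivariate.swap (flipD f)).coeff n) := by
  have h : flipD f = Bivariate.swap (Bivariate.swap (flipD f)) :=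
    (Bivariate.swap_swap_apply _).symm
  rw [← flipD_flipD f, flipD_flipD (flipD f)]
  conv_lhs => rw [h, (Bivariate.swap (flipD f)).as_sum_support]
  rw [map_sum, map_sum]
  refine Finset.sum_congr rfl fun n _ => ?_
  rw [Bivariate.swap_monomial, ← flipD_aeval, map_mul, flipD_flipD, flipD_C, vVar, C_pow, mul_comm]

theorem coeff_coeff_swap (f : k[X][X]) (i n : ℕ) :
    ((Bivariate.swap f).coeff i).coeff n = (f.coeff n).coeff i := by
  induction f using Polynomial.induction_on' with
  | add p q hp hq => simp only [map_add, coeff_add, hp, hq]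
  | monomial m p =>
    induction p using Polynomial.induction_on' with
    | add p q hp hq => simp only [map_add, coeff_add, hp, hq]
    | monomial s a =>
      rw [Bivariate.swap_monomial_monomial]
      simp only [coeff_monomial]
      split_ifs <;> simp_all [coeff_monomial]

theorem colCoeff_rowMat (j : Fin N) (i : ℕ) (l : Fin N) (r : Fin N → k[X]) :
    colCoeff j i (rowMat l r) = Pi.single l (C ((r j).coeff i)) := by
  ext1 m
  rw [colCoeff_apply, rowMat_apply]
  by_cases h : m = l
  · subst h
    simp [flipD_aeval, coeff_map]
  · simp [h]

/-- Every matrix is the combination of its rows over the powers of `v`. -/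
theorem eq_sum_rowMat (c : Cend k N) : ∃ m : ℕ,
    c = ∑ l, ∑ n ∈ Finset.range m, vVar k ^ n • rowMat l (rowCoeff l n c) := by
  have hbound : ∀ f : Fin N × Fin N → ℕ, ∃ m, ∀ p, f p ≤ m := fun f =>
    (Set.finite_range f).bddAbove.imp fun m hm p => hm ⟨p, rfl⟩
  obtain ⟨m, hm⟩ := hbound fun p => (Bivariate.swap (flipD (c p.1 p.2))).natDegree
  refine ⟨m + 1, ?_⟩
  ext1 i j
  rw [Matrix.sum_apply, Finset.sum_eq_single i (fun l _ hl => by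
    simp [Matrix.sum_apply, rowMat_apply, hl.symm]) (by simp)]
  simp only [Matrix.sum_apply, Matrix.smul_apply, rowMat_apply, rowCoeff]
  simp only [if_true, smul_eq_mul]
  refine (eq_sum_vVar_mul (c i j)).trans (Finset.sum_subset (fun n hn => ?_) fun n _ hn => ?_)
  · exact Finset.mem_range.2
      (Nat.lt_succ_of_le ((le_natDegree_of_mem_supp n hn).trans (hm (i, j))))
  · rw [notMem_support_iff.1 hn, map_zero, mul_zero]

/-- The submodule of `k[v]^N` spanned by the rows of the elements of `I`. -/
noncomputable def rowSpan (I : Submodule k (Cend k N)) : Submodule k[X] (Fin N → k[X]) :=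
  Submodule.span k[X] {r | ∃ c ∈ I, ∃ l n, r = rowCoeff l n c}

theorem rowMat_mem_vSpan [IsAlgClosed k] {S : Submodule k (Cend k N)}
    (hS : IsConformalSubalgebra S) (hirr : IsIrreducibleOn S) (l : Fin N)
    {r : Fin N → k[X]} (hr : r ∈ rowSpan (vSpan S)) : rowMat l r ∈ vSpan S := by
  induction hr using Submodule.span_induction with
  | mem r hr =>
    obtain ⟨c, hc, m, n, rfl⟩ := hr
    -- The operator sending the basis vector `v ^ n e_m` to `e_l` and the others to `0`.
    let T : Module.End k (VN k N) :=
      { toFun := fun u => Pi.single l (C ((u m).coeff n))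
        map_add' := fun u w => by
          rw [← Pi.single_add]
          simp
        map_smul' := fun a u => by
          rw [RingHom.id_apply, ← Pi.single_smul]
          simp [smul_eq_C_mul] }
    obtain ⟨c', hc', e⟩ := exists_mem_vSpan_colCoeff_eq l.pos hS hirr T hc
    convert hc'
    refine eq_of_colCoeff_eq fun j i => ?_
    rw [e, colCoeff_rowMat, rowCoeff, coeff_coeff_swap]
    rfl
  | zero => rw [map_zero]; exact zero_mem _
  | add r t _ _ hr ht => rw [map_add]; exact add_mem hr ht
  | smul p r _ hr =>
    rw [rowMat_smul]
    exact smul_mem_of_vVar_dVar (fun _ => vSpan_vVar_smul_mem)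
      (fun _ => vSpan_dVar_smul_mem hS) _ hr

/-! ### The left ideals `Cend_{N,Q}` -/

theorem smul_mem_CendQ (Q : Matrix (Fin N) (Fin N) k[X]) (f : k[X][X]) {c : Cend k N}
    (hc : c ∈ CendQ Q) : f • c ∈ CendQ Q := by
  obtain ⟨M, rfl⟩ := hc
  exact ⟨f • M, Matrix.smul_mul f M _⟩

theorem rowMat_mem_CendQ (Q : Matrix (Fin N) (Fin N) k[X]) (l : Fin N) {r : Fin N → k[X]}
    (hr : r ∈ Submodule.span k[X] (Set.range Q)) : rowMat l r ∈ CendQ Q := by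
  induction hr using Submodule.span_induction with
  | mem r hr =>
    obtain ⟨m, rfl⟩ := hr
    refine ⟨Matrix.single l m 1, ?_⟩
    rw [LinearMap.mulRight_apply]
    ext1 i j
    by_cases h : i = l
    · subst h
      simp [rowMat_apply, shiftQ]
    · simp [rowMat_apply, h]
  | zero => rw [map_zero]; exact zero_mem _
  | add r t _ _ hr ht => rw [map_add]; exact add_mem hr ht
  | smul p r _ hr => rw [rowMat_smul]; exact smul_mem_CendQ Q _ hr

theorem mul_shiftQ_eq_sum (M : Cend k N) (Q : Matrix (Fin N) (Fin N) k[X]) :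
    M * shiftQ Q = ∑ l, ∑ m, M l m • rowMat l (Q m) := by
  ext1 i j
  rw [Matrix.sum_apply, Finset.sum_eq_single i (fun l _ hl => by
    simp [Matrix.sum_apply, rowMat_apply, hl.symm]) (by simp)]
  simp [Matrix.sum_apply, rowMat_apply, Matrix.mul_apply, shiftQ]

theorem delta_mul_shiftQ (M : Cend k N) (Q : Matrix (Fin N) (Fin N) k[X]) :
    delta (M * shiftQ Q) = delta M * shiftQ Q := by
  have h : ∀ f : k[X], derivative (aeval (-dVar k + vVar k) f) +
      pderivV (aeval (-dVar k + vVar k) f) = 0 := by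
    intro f
    rw [← flipD_flipD (derivative (aeval (-dVar k + vVar k) f) + _), ← pderivV_flipD, flipD_aeval]
    have : pderivV (f.map C) = 0 := by
      ext1 s
      simp [coeff_pderivV]
    rw [this, map_zero]
  let d : k[X][X] →+ k[X][X] := AddMonoidHom.mk' (fun f => derivative f + pderivV f) fun f g => by
    rw [derivative_add, pderivV_add]
    abel
  ext1 i j
  change d ((M * shiftQ Q) i j) = (delta M * shiftQ Q) i j
  rw [Matrix.mul_apply, Matrix.mul_apply, map_sum]
  refine Finset.sum_congr rfl fun m _ => ?_
  change derivative (_ * aeval (-dVar k + vVar k) (Q m j)) +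
    pderivV (_ * aeval (-dVar k + vVar k) (Q m j)) = _ * aeval (-dVar k + vVar k) (Q m j)
  rw [derivative_add_pderivV_mul, h, mul_zero, add_zero]
  rfl

theorem isLeftIdeal_CendQ (Q : Matrix (Fin N) (Fin N) k[X]) : IsLeftIdeal (CendQ Q) where
  D_mem _ ha := smul_mem_CendQ Q _ ha
  nprod_mem := by
    rintro a _ ⟨M, rfl⟩ n
    refine ⟨nprod a n M, ?_⟩
    have h : ∀ m, delta^[m] (M * shiftQ Q) = delta^[m] M * shiftQ Q := by
      intro m
      induction m with
      | zero => rfl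
      | succ m ih => rw [Function.iterate_succ_apply', ih, delta_mul_shiftQ,
          Function.iterate_succ_apply']
    rw [LinearMap.mulRight_apply, LinearMap.mulRight_apply, nprod, nprod, Finset.sum_mul]
    refine Finset.sum_congr rfl fun s _ => ?_
    rw [h, Matrix.smul_mul, Matrix.mul_assoc]

/-! ### A generating matrix and its determinant -/

/-- Over the principal ideal domain `k[v]`, a submodule of `k[v]^N` is the row space of a square
matrix. -/
theorem exists_span_range_eq (J : Submodule k[X] (Fin N → k[X])) :
    ∃ Q : Matrix (Fin N) (Fin N) k[X], Submodule.span k[X] (Set.range Q) = J := by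
  obtain ⟨n, ⟨b⟩⟩ := Submodule.nonempty_basis_of_pid (Pi.basisFun k[X] (Fin N)) J
  have hn : n ≤ N := by
    have h := Submodule.finrank_le J
    rwa [Module.finrank_eq_card_basis b, Module.finrank_fin_fun, Fintype.card_fin] at h
  have hJ : Submodule.span k[X] (Set.range fun i => (b i : Fin N → k[X])) = J := by
    have h := congrArg (Submodule.map J.subtype) b.span_eq
    rwa [Submodule.map_span, Submodule.map_subtype_top, ← Set.range_comp] at h
  refine ⟨fun i => if h : (i : ℕ) < n then b ⟨i, h⟩ else 0, le_antisymm ?_ ?_⟩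
  · rw [Submodule.span_le]
    rintro _ ⟨i, rfl⟩
    dsimp only
    split_ifs with h
    · exact (b ⟨i, h⟩).2
    · exact zero_mem J
  · conv_lhs => rw [← hJ]
    rw [Submodule.span_le]
    rintro _ ⟨i, rfl⟩
    refine Submodule.subset_span ⟨⟨i, i.2.trans_le hn⟩, ?_⟩
    simp

theorem act_add_left (a b : Cend k N) (n : ℕ) (u : VN k N) :
    act (a + b) n u = act a n u + act b n u := by
  have h : ∀ s, dcoeff (a + b) s = dcoeff a s + dcoeff b s := by
    intro s
    ext1 i j
    simp [dcoeff, mul_add]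
  simp only [act, h, Matrix.add_mulVec, smul_add, Finset.sum_add_distrib]

theorem act_smul_left (r : k) (a : Cend k N) (n : ℕ) (u : VN k N) :
    act (r • a) n u = r • act a n u := by
  have h : ∀ s, dcoeff (r • a) s = r • dcoeff a s := by
    intro s
    ext1 i j
    simp [dcoeff]
  simp only [act, h, Matrix.smul_mulVec, Finset.smul_sum]
  exact Finset.sum_congr rfl fun s _ => smul_comm _ _ _

theorem act_vVar_smul (a : Cend k N) (n : ℕ) (u : VN k N) :
    act (vVar k • a) n u = (X : k[X]) • act a n u := by
  have h : ∀ s, dcoeff (vVar k • a) s = (X : k[X]) • dcoeff a s := by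
    intro s
    ext1 i j
    simp only [dcoeff, Matrix.map_apply, Matrix.smul_apply, vVar, smul_eq_mul, coeff_C_mul]
    ring
  simp only [act, h, Matrix.smul_mulVec, Finset.smul_sum]
  exact Finset.sum_congr rfl fun s _ => smul_comm _ _ _

/-- `act` inherits `D a ∘_n u = -n (a ∘_{n-1} u)` from `nprod`, of which it gives the columns. -/
theorem act_dVar_smul (a : Cend k N) (n : ℕ) (u : VN k N) :
    act (dVar k • a) n u = -(n • act a (n - 1) u) := by
  rcases Nat.eq_zero_or_pos N with rfl | hN
  · exact Subsingleton.elim _ _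
  · let j : Fin N := ⟨0, hN⟩
    have hu : colCoeff j 0 (incl (Matrix.of fun i _ => u i)) = u := by
      ext1 l
      simp [colCoeff_apply, incl, flipD_C]
    rw [← hu, ← colCoeff_nprod, ← colCoeff_nprod, nprod_D_left, map_neg, map_nsmul]

/-- Multiplication by `v - D` in `Cend_N` precomposes the operators on `V_N` with `D`. -/
theorem act_aeval_smul (p : k[X]) (a : Cend k N) (n : ℕ) (u : VN k N) :
    act (aeval (-dVar k + vVar k) p • a) n u = act a n (p • u) := by
  induction p using Polynomial.induction_on' with
  | add p q hp hq =>
    rw [map_add, add_smul, act_add_left, hp, hq, add_smul]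
    exact (map_add (actEnd a n) _ _).symm
  | monomial m r =>
    induction m generalizing a n with
    | zero =>
      have h : (monomial 0 r : k[X]) • u = r • u := by
        ext1 i
        simp [smul_eq_C_mul]
      rw [aeval_monomial, pow_zero, mul_one, algebraMap_smul, act_smul_left, h]
      exact (map_smul (actEnd a n) r u).symm
    | succ m ih =>
      rw [← monomial_mul_X, map_mul, aeval_X, mul_smul, ih, mul_comm, mul_smul, act_X_smul,
        add_smul, act_add_left, neg_smul, ← neg_one_smul k (dVar k • a), act_smul_left,
        act_dVar_smul, act_vVar_smul, neg_one_smul, neg_neg, add_comm]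

theorem act_sum_left {ι : Type*} (s : Finset ι) (f : ι → Cend k N) (n : ℕ) (u : VN k N) :
    act (∑ x ∈ s, f x) n u = ∑ x ∈ s, act (f x) n u :=
  map_sum (AddMonoidHom.mk' (fun a => act a n u) fun a b => act_add_left a b n u) f s

theorem act_rowMat (l : Fin N) (r : Fin N → k[X]) (n : ℕ) (u : VN k N) :
    act (rowMat l r) n u = Pi.single l (derivative^[n] (r ⬝ᵥ u)) := by
  have h1 : rowMat l r =
      ∑ j, aeval (-dVar k + vVar k) (r j) • incl (Matrix.single l j (1 : k[X])) := by
    ext1 i m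
    rw [Matrix.sum_apply, Finset.sum_eq_single m (fun j _ hj => by simp [incl, hj]) (by simp)]
    by_cases h : i = l
    · subst h
      simp [rowMat_apply, incl]
    · simp [rowMat_apply, incl, h, Ne.symm h]
  have h2 : ∀ (A : Matrix (Fin N) (Fin N) k[X]) (w : VN k N),
      act (incl A) n w = A.mulVec fun i => derivative^[n] (w i) := by
    intro A w
    rw [act, Finset.sum_eq_single_of_mem 0 (by simp)]
    · have : dcoeff (incl A) 0 = A := by
        ext1 i j
        simp [dcoeff, incl]
      rw [this, Nat.choose_zero_right, one_smul, Nat.sub_zero]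
    · intro s _ hs
      have : dcoeff (incl A) s = 0 := by
        ext1 i j
        simp [dcoeff, incl, coeff_C, hs]
      rw [this, Matrix.zero_mulVec, smul_zero]
  rw [h1, act_sum_left]
  ext1 i
  by_cases h : i = l
  · subst h
    simp [act_aeval_smul, h2, dotProduct, Finset.sum_apply, Matrix.single_mulVec,
      iterate_derivative_sum]
  · simp [act_aeval_smul, h2, h, Finset.sum_apply, Matrix.single_mulVec]

/-- The operators of `M Q(v - D)` factor through `Q` on the right. -/
theorem act_eq_zero_of_mem_CendQ {Q : Matrix (Fin N) (Fin N) k[X]} {u : VN k N}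
    (hu : Q.mulVec u = 0) {c : Cend k N} (hc : c ∈ CendQ Q) (n : ℕ) : act c n u = 0 := by
  let I : Submodule k (Cend k N) :=
    { carrier := {c | ∀ n, act c n u = 0}
      add_mem' := fun {a b} ha hb n => by rw [act_add_left, ha n, hb n, add_zero]
      zero_mem' := fun n => by simpa using act_smul_left (0 : k) (0 : Cend k N) n u
      smul_mem' := fun r a ha n => by rw [act_smul_left, ha n, smul_zero] }
  obtain ⟨M, rfl⟩ := hc
  have hI : M * shiftQ Q ∈ I := by
    rw [mul_shiftQ_eq_sum]
    refine sum_mem fun l _ => sum_mem fun m _ => smul_mem_of_vVar_dVar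
      (fun a ha n => ?_) (fun a ha n => ?_) _ fun n => ?_
    · rw [act_vVar_smul, ha n, smul_zero]
    · rw [act_dVar_smul, ha (n - 1), smul_zero, neg_zero]
    · have h : Q m ⬝ᵥ u = 0 := congrFun hu m
      rw [act_rowMat, h, iterate_derivative_zero, Pi.single_zero]
  exact hI n

theorem det_ne_zero_of_le_CendQ (hN : 0 < N) {S : Submodule k (Cend k N)}
    (hirr : IsIrreducibleOn S) {Q : Matrix (Fin N) (Fin N) k[X]} (hSQ : S ≤ CendQ Q) :
    Q.det ≠ 0 := by
  intro hdet
  obtain ⟨w, hw, hQw⟩ := Matrix.exists_mulVec_eq_zero_iff.2 hdet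
  have htop : LinearMap.ker Q.mulVecLin = ⊤ := by
    refine (hirr (LinearMap.ker Q.mulVecLin) fun a ha n u hu => ?_).resolve_left fun h => hw ?_
    · rw [act_eq_zero_of_mem_CendQ hu (hSQ ha)]
      exact zero_mem _
    · have h1 : w ∈ LinearMap.ker Q.mulVecLin := hQw
      rwa [h, Submodule.mem_bot] at h1
  let U : Submodule k[X] (VN k N) := LinearMap.range (LinearMap.lsmul k[X] (VN k N) X)
  have hact : ∀ a ∈ S, ∀ n : ℕ, ∀ u ∈ U, act a n u ∈ U := fun a ha n u _ => by
    have hu : u ∈ LinearMap.ker Q.mulVecLin := by rw [htop]; trivial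
    rw [act_eq_zero_of_mem_CendQ hu (hSQ ha)]
    exact zero_mem _
  let e : VN k N := Pi.single ⟨0, hN⟩ 1
  rcases hirr U hact with h | h
  · have h1 : (X : k[X]) • e ∈ U := ⟨e, rfl⟩
    rw [h, Submodule.mem_bot] at h1
    simpa [e] using congrFun h1 ⟨0, hN⟩
  · have h1 : e ∈ U := by rw [h]; trivial
    obtain ⟨u, hu⟩ := h1
    have h2 := congrArg (fun p => coeff p 0) (congrFun hu ⟨0, hN⟩)
    simp [e] at h2

end ConfCend

theorem theorem5p1p1 {k : Type*} [Field k] [IsAlgClosed k] [CharZero k] (N : ℕ) (hN : 0 < N)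
    (S : Submodule k (ConfCend.Cend k N))
    (hS : ConfCend.IsConformalSubalgebra S) (hirr : ConfCend.IsIrreducibleOn S) :
    ∃ Q : Matrix (Fin N) (Fin N) (Polynomial k), Q.det ≠ 0 ∧
      ConfCend.vSpan S = ConfCend.CendQ Q ∧ ConfCend.IsLeftIdeal (ConfCend.CendQ Q) := by
  obtain ⟨Q, hQ⟩ := ConfCend.exists_span_range_eq (ConfCend.rowSpan (ConfCend.vSpan S))
  have heq : ConfCend.vSpan S = ConfCend.CendQ Q := by
    refine le_antisymm (fun c hc => ?_) ?_
    · obtain ⟨m, hm⟩ := ConfCend.eq_sum_rowMat c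
      rw [hm]
      refine sum_mem fun l _ => sum_mem fun n _ => ConfCend.smul_mem_CendQ Q _ ?_
      refine ConfCend.rowMat_mem_CendQ Q l ?_
      rw [hQ]
      exact Submodule.subset_span ⟨c, hc, l, n, rfl⟩
    · rintro _ ⟨M, rfl⟩
      rw [LinearMap.mulRight_apply, ConfCend.mul_shiftQ_eq_sum]
      refine sum_mem fun l _ => sum_mem fun m _ => ConfCend.smul_mem_of_vVar_dVar
        (fun _ => ConfCend.vSpan_vVar_smul_mem) (fun _ => ConfCend.vSpan_dVar_smul_mem hS) _ ?_
      refine ConfCend.rowMat_mem_vSpan hS hirr l ?_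
      rw [← hQ]
      exact Submodule.subset_span ⟨m, rfl⟩
  refine ⟨Q, ConfCend.det_ne_zero_of_le_CendQ hN hirr ?_, heq, ConfCend.isLeftIdeal_CendQ Q⟩
  rw [← heq]
  refine fun a ha => Submodule.mem_iSup_of_mem 0 ⟨a, ha, ?_⟩
  simp
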